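/- Let $A\in\mathbb R^{n\times n}$, $B\in\mathbb R^{n\times m}$, $K\in\mathbb R^{m\times n}$, let $G=G^\top\succ0$ be a real $m\times m$ matrix, let $c\in\mathbb R^n$ with $c^\top B\neq 0$, and let $\alpha>0$. Put $A_0:=A-BK$ and assume that $A_0$ is Hurwitz. Define $a:=B^\top c$, $\beta:=a^\top G^{-1}a$, $$U:=\frac{BG^{-1}a}{\beta},\qquad V^\top:=c^\top(A_0+\alpha I),\qquad L(s):=V^\top(sI-A_0)^{-1}U .$$ Let $\Omega_{\rm gc}:=\{\omega\ge 0: |L(j\omega)|=1\}$ be the set of gain-crossover frequencies, assume that it is nonempty and bounded above, and let $\omega_{\max}:=\sup\Omega_{\rm gc}$. Suppose that for some $\bar\phi\in[0,\pi/2]$, with $c_\phi:=\cos\bar\phi$, $r_\phi:=\sin\bar\phi$ and $A_\phi:=A_0-c_\phi UV^\top$, there exists a real matrix $P=P^\top\succ0$ satisfying the phase LMI $$\begin{bmatrix}A_\phi^\top P+PA_\phi & PU & r_\phi V\\ U^\top P & -1 & 0\\ r_\phi V^\top & 0 & -1\end{bmatrix}\prec 0 .$$ Then the delayed loop equation $$1+e^{-s\tau}L(s)=0$$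 has no solution $s\in\mathbb C$ with $\operatorname{Re}s\ge0$, for every $0\le\tau\le\bar\phi/\omega_{\max}$; if $\omega_{\max}=0$, this holds for every $\tau\ge 0$. -/

import Mathlib

namespace SafetyFilter

open Matrix

/-- A real square matrix is Hurwitz if all its complex eigenvalues have negative real part. -/
def IsHurwitz {n : ℕ} (M : Matrix (Fin n) (Fin n) ℝ) : Prop :=
  ∀ z ∈ spectrum ℂ (M.map (fun x : ℝ => (x : ℂ))), z.re < 0

/-- The input direction `U = B G⁻¹ a / β`, where `a = Bᵀ c` and `β = aᵀ G⁻¹ a`. -/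
noncomputable def inputDirection {n m : ℕ} (B : Matrix (Fin n) (Fin m) ℝ) (c : Fin n → ℝ)
    (G : Matrix (Fin m) (Fin m) ℝ) : Fin n → ℝ :=
  ((Bᵀ *ᵥ c) ⬝ᵥ (G⁻¹ *ᵥ (Bᵀ *ᵥ c)))⁻¹ • (B *ᵥ (G⁻¹ *ᵥ (Bᵀ *ᵥ c)))

/-- The output vector `V`, given by `Vᵀ = cᵀ (A₀ + α I)`. -/
def outputVector {n : ℕ} (A₀ : Matrix (Fin n) (Fin n) ℝ) (c : Fin n → ℝ) (α : ℝ) : Fin n → ℝ :=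
  c ᵥ* (A₀ + α • (1 : Matrix (Fin n) (Fin n) ℝ))

/-- The scalar loop transfer function `L(s) = Vᵀ (s I - A₀)⁻¹ U`. -/
noncomputable def loopTransfer {n : ℕ} (A₀ : Matrix (Fin n) (Fin n) ℝ) (U V : Fin n → ℝ)
    (s : ℂ) : ℂ :=
  (fun i => (V i : ℂ)) ⬝ᵥ
    ((s • (1 : Matrix (Fin n) (Fin n) ℂ) - A₀.map (fun x : ℝ => (x : ℂ)))⁻¹ *ᵥ
      (fun i => (U i : ℂ)))

/-- The gain-crossover set `{ω ≥ 0 : |L(jω)| = 1}`. -/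
def gainCrossoverSet {n : ℕ} (A₀ : Matrix (Fin n) (Fin n) ℝ) (U V : Fin n → ℝ) : Set ℝ :=
  {ω : ℝ | 0 ≤ ω ∧ ‖loopTransfer A₀ U V ((ω : ℂ) * Complex.I)‖ = 1}

/-- The matrix `A_φ = A₀ - cos φ · U Vᵀ`. -/
noncomputable def phaseMatrix {n : ℕ} (A₀ : Matrix (Fin n) (Fin n) ℝ) (U V : Fin n → ℝ)
    (φ : ℝ) : Matrix (Fin n) (Fin n) ℝ :=
  A₀ - Real.cos φ • vecMulVec U V

/-- The symmetric block matrix of the phase LMI, with `r = sin φ`: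
`[[A_φᵀ P + P A_φ, P U, r V], [Uᵀ P, -1, 0], [r Vᵀ, 0, -1]]`. -/
noncomputable def phaseLMIMatrix {n : ℕ} (A₀ : Matrix (Fin n) (Fin n) ℝ) (U V : Fin n → ℝ)
    (φ : ℝ) (P : Matrix (Fin n) (Fin n) ℝ) :
    Matrix (Fin n ⊕ (Fin 1 ⊕ Fin 1)) (Fin n ⊕ (Fin 1 ⊕ Fin 1)) ℝ :=
  fromBlocks
    ((phaseMatrix A₀ U V φ)ᵀ * P + P * phaseMatrix A₀ U V φ)
    (fromCols (replicateCol (Fin 1) (P *ᵥ U)) (replicateCol (Fin 1) (Real.sin φ • V)))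
    (fromRows (replicateRow (Fin 1) (U ᵥ* P)) (replicateRow (Fin 1) (Real.sin φ • V)))
    (fromBlocks (-1) 0 0 (-1))

/-- The phase LMI at `φ`: some symmetric `P ≻ 0` makes the block matrix negative definite. -/
def PhaseLMI {n : ℕ} (A₀ : Matrix (Fin n) (Fin n) ℝ) (U V : Fin n → ℝ) (φ : ℝ) : Prop :=
  ∃ P : Matrix (Fin n) (Fin n) ℝ, P.PosDef ∧ (-(phaseLMIMatrix A₀ U V φ P)).PosDef

end SafetyFilter

namespace SafetyFilter

/-! ### Zeros in the closed right half-plane as the delay grows -/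

open Matrix Filter Topology Set

/-! The LMI is a frequency-domain inequality in disguise. Evaluating its quadratic form at the real
and imaginary parts of the state `(sI - A₀)⁻¹ U`, with auxiliary entries chosen to cancel the input
terms, gives `|sin φ · L(s)| < |1 + cos φ · L(s)|` for `Re s ≥ 0` (`PhaseLMI.sin_sq_mul_normSq_lt`).
Where `|L| = 1` this says `Re L > -cos φ`.

A root `iω` of the delayed equation with `ω ≥ 0` has `L(iω) = -e^{iωτ}`, so `ω` is a gain crossover
and `ωτ ≤ φ`. Hence `Re L = -cos(ωτ) ≤ -cos φ`, a contradiction; conjugation handles `ω < 0`. At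
zero delay a root means `L = -1`, excluded in the same way.

It remains to see that roots enter the right half-plane only through the axis
(`one_add_exp_mul_ne_zero_of_axis`). Roots are bounded because `L` vanishes at infinity, so a least
delay with a root exists. That root is interior and isolated, and the open mapping theorem keeps a
root nearby for slightly smaller delays, contradicting minimality. -/

/-- Zero-crossing argument: roots of `1 + e^{-sτ} L(s)` in the closed right half-plane
can only appear through the imaginary axis as the delay grows from `0`. -/
theorem one_add_exp_mul_ne_zero_of_axis {L : ℂ → ℂ}
    (hL : ∀ s : ℂ, 0 ≤ s.re → DifferentiableAt ℂ L s)
    (hL0 : Tendsto L (Bornology.cobounded ℂ) (𝓝 0)) {T : ℝ} (hT : 0 ≤ T)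
    (hzero : ∀ s : ℂ, 0 ≤ s.re → 1 + L s ≠ 0)
    (haxis : ∀ τ ∈ Icc 0 T, ∀ s : ℂ, s.re = 0 → 1 + Complex.exp (-(s * (τ : ℂ))) * L s ≠ 0)
    (s : ℂ) (hs : 0 ≤ s.re) : 1 + Complex.exp (-(s * (T : ℂ))) * L s ≠ 0 := by
  intro hroot
  set F : ℂ → ℝ → ℂ := fun z τ => 1 + Complex.exp (-(z * (τ : ℂ))) * L z with hF
  obtain ⟨R, hR⟩ : ∃ R : ℝ, ∀ z : ℂ, R < ‖z‖ → ‖L z‖ < 1 := by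
    have h : ∀ᶠ z in Bornology.cobounded ℂ, ‖L z‖ < 1 := by
      have := hL0.norm
      rw [norm_zero] at this
      exact this.eventually_lt_const one_pos
    obtain ⟨R, -, hR⟩ := (hasBasis_cobounded_norm (E := ℂ)).eventually_iff.1 h
    exact ⟨R, fun z hz => hR (le_of_lt hz)⟩
  have hbound : ∀ z : ℂ, 0 ≤ z.re → ∀ τ : ℝ, 0 ≤ τ → F z τ = 0 → ‖z‖ ≤ R := by
    intro z hz τ hτ h0
    by_contra! hlt
    have h1 : Complex.exp (-(z * (τ : ℂ))) * L z = -1 := by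
      linear_combination h0
    have h2 : ‖Complex.exp (-(z * (τ : ℂ)))‖ ≤ 1 := by
      rw [Complex.norm_exp, Real.exp_le_one_iff]
      simpa using mul_nonneg hz hτ
    have h3 := congrArg norm h1
    rw [norm_mul, norm_neg, norm_one] at h3
    nlinarith [hR z hlt, norm_nonneg (L z), norm_nonneg (Complex.exp (-(z * (τ : ℂ))))]
  have hcont : ContinuousOn (fun p : ℂ × ℝ => F p.1 p.2) {p | 0 ≤ p.1.re} := by
    have hLc : ContinuousOn (fun p : ℂ × ℝ => L p.1) {p | 0 ≤ p.1.re} := by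
      intro p hp
      exact ((hL p.1 hp).continuousAt.comp continuousAt_fst).continuousWithinAt
    exact continuousOn_const.add (ContinuousOn.mul (by fun_prop) hLc)
  have hana : ∀ τ : ℝ, AnalyticOnNhd ℂ (fun z => F z τ) {z | 0 < z.re} := by
    intro τ
    refine DifferentiableOn.analyticOnNhd ?_ (isOpen_lt continuous_const Complex.continuous_re)
    intro z hz
    have := hL z (le_of_lt hz)
    exact DifferentiableAt.differentiableWithinAt (by fun_prop)
  have hconv : IsPreconnected {z : ℂ | 0 < z.re} :=
    (convex_halfSpace_re_gt 0).isPreconnected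
  have hK : IsCompact ((Metric.closedBall (0 : ℂ) R ∩ {z | 0 ≤ z.re}) ×ˢ Icc (0 : ℝ) T) :=
    ((isCompact_closedBall _ _).inter_right
      (isClosed_le continuous_const Complex.continuous_re)).prod isCompact_Icc
  have hZ : IsCompact (((Metric.closedBall (0 : ℂ) R ∩ {z | 0 ≤ z.re}) ×ˢ Icc (0 : ℝ) T) ∩
      (fun p : ℂ × ℝ => F p.1 p.2) ⁻¹' {0}) := by
    refine hK.of_isClosed_subset ?_ inter_subset_left
    exact (hcont.mono fun p hp => hp.1.2).preimage_isClosed_of_isClosed hK.isClosed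
      isClosed_singleton
  -- The pair of root and delay is chosen with `τ₀` minimal over the compact zero set.
  obtain ⟨⟨s₀, τ₀⟩, ⟨⟨⟨-, hs₀⟩, hτ₀⟩, hF₀⟩, hmin⟩ := hZ.exists_isMinOn
    ⟨(s, T), ⟨⟨by simpa using hbound s hs T hT hroot, hs⟩, hT, le_rfl⟩, hroot⟩
    continuous_snd.continuousOn
  simp only [mem_ofPred_eq, mem_preimage, mem_singleton_iff] at hs₀ hF₀ hτ₀
  have hleast : ∀ z : ℂ, 0 ≤ z.re → ∀ τ ∈ Ico 0 τ₀, F z τ ≠ 0 := by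
    intro z hz τ hτ h0
    have : τ₀ ≤ τ := hmin (a := (z, τ))
      ⟨⟨⟨by simpa using hbound z hz τ hτ.1 h0, hz⟩, hτ.1, hτ.2.le.trans hτ₀.2⟩, h0⟩
    exact absurd hτ.2 this.not_gt
  have hs₀' : 0 < s₀.re := hs₀.lt_of_ne fun h => haxis τ₀ hτ₀ s₀ h.symm hF₀
  have hτ₀' : 0 < τ₀ := by
    refine hτ₀.1.lt_of_ne ?_
    rintro rfl
    exact hzero s₀ hs₀ (by simpa [hF] using hF₀)
  have hisol : ∀ᶠ z in 𝓝[≠] s₀, F z τ₀ ≠ 0 := by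
    by_contra hne
    have hfreq : ∃ᶠ z in 𝓝[≠] s₀, F z τ₀ = 0 :=
      (not_eventually.1 hne).mono fun _ => not_not.1
    have heq := (hana τ₀).eqOn_zero_of_preconnected_of_frequently_eq_zero hconv hs₀' hfreq
    -- If the zeros accumulated at `s₀`, `F · τ₀` would vanish on the whole half-plane, even at `|R|
    -- + 1`, which is beyond the root bound.
    have hpos : 0 < ((|R| + 1 : ℝ) : ℂ).re := by
      rw [Complex.ofReal_re]; positivity
    have h1 := hbound _ hpos.le τ₀ hτ₀.1 (heq hpos)
    rw [Complex.norm_real, Real.norm_of_nonneg (by positivity)] at h1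
    linarith [le_abs_self R]
  obtain ⟨r, hr, hball, hne⟩ : ∃ r > 0, Metric.closedBall s₀ r ⊆ {z | 0 < z.re} ∧
      ∀ z ∈ Metric.sphere s₀ r, F z τ₀ ≠ 0 := by
    rw [eventually_nhdsWithin_iff] at hisol
    have hopen : ∀ᶠ z in 𝓝 s₀, 0 < z.re :=
      (isOpen_lt continuous_const Complex.continuous_re).mem_nhds hs₀'
    obtain ⟨r, hr, h⟩ := Metric.nhds_basis_closedBall.eventually_iff.1 (hisol.and hopen)
    refine ⟨r, hr, fun z hz => (h hz).2, fun z hz => (h (Metric.sphere_subset_closedBall hz)).1 ?_⟩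
    rintro rfl
    simp [hr.ne] at hz
  have hsph : IsCompact (Metric.sphere s₀ r) := isCompact_sphere _ _
  have hslice : ∀ τ : ℝ, ContinuousOn (fun z => F z τ) {z | 0 ≤ z.re} := fun τ =>
    hcont.comp (f := fun z : ℂ => (z, τ)) (by fun_prop) fun z hz => hz
  have hsub : Metric.sphere s₀ r ⊆ {z : ℂ | 0 ≤ z.re} := fun z hz =>
    show 0 ≤ z.re from le_of_lt (hball (Metric.sphere_subset_closedBall hz))
  obtain ⟨w, hw, hwmin⟩ := hsph.exists_isMinOn (NormedSpace.sphere_nonempty.2 hr.le)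
    ((hslice τ₀).mono hsub).norm
  -- Half the minimum of `‖F · τ₀‖` on the circle: the other half absorbs the change of `F` for `τ`
  -- near `τ₀`.
  set ε := ‖F w τ₀‖ / 2 with hε
  have hεpos : 0 < ε := half_pos (norm_pos_iff.2 (hne w hw))
  have hcontAt : ∀ z : ℂ, 0 < z.re → ContinuousAt (fun p : ℂ × ℝ => F p.1 p.2) (z, τ₀) :=
    fun z hz => hcont.continuousAt <| mem_of_superset
      ((isOpen_lt continuous_const (Complex.continuous_re.comp continuous_fst)).mem_nhds
        (show 0 < (z, τ₀).1.re from hz)) fun p (hp : 0 < p.1.re) => hp.le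
  have hF₀c : ContinuousAt (fun τ => F s₀ τ) τ₀ :=
    (hcontAt s₀ hs₀').comp (f := fun τ : ℝ => (s₀, τ)) (by fun_prop)
  have hev1 : ∀ᶠ τ in 𝓝 τ₀, ∀ z ∈ Metric.sphere s₀ r, ε < ‖F z τ - F s₀ τ‖ := by
    refine hsph.eventually_forall_of_forall_eventually fun z hz => ?_
    have hc : ContinuousAt (fun p : ℝ × ℂ => ‖F p.2 p.1 - F s₀ p.1‖) (τ₀, z) := by
      refine ContinuousAt.norm (ContinuousAt.sub ?_ ?_)
      · exact ContinuousAt.comp (f := Prod.swap) (g := fun p : ℂ × ℝ => F p.1 p.2)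
          (hcontAt z (hball (Metric.sphere_subset_closedBall hz))) continuous_swap.continuousAt
      · exact ContinuousAt.comp (f := Prod.fst) (g := fun τ => F s₀ τ) hF₀c continuousAt_fst
    have hlt : ε < ‖F z τ₀ - F s₀ τ₀‖ := by
      rw [hF₀, sub_zero]
      have : ‖F w τ₀‖ ≤ ‖F z τ₀‖ := hwmin hz
      linarith
    exact hc.eventually (lt_mem_nhds hlt)
  have hev2 : ∀ᶠ τ in 𝓝 τ₀, ‖F s₀ τ‖ < ε / 2 := by
    refine hF₀c.norm.eventually (gt_mem_nhds ?_)
    simp only [hF₀, norm_zero]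
    positivity
  obtain ⟨τ, ⟨⟨h1, h2⟩, h3⟩, hlt⟩ := (((hev1.and hev2).and (lt_mem_nhds hτ₀')).filter_mono
    nhdsWithin_le_nhds |>.and (self_mem_nhdsWithin (s := Iio τ₀))).exists
  have hdiff : DiffContOnCl ℂ (fun z => F z τ) (Metric.ball s₀ r) :=
    DifferentiableOn.diffContOnCl_ball (U := {z | 0 < z.re}) (hana τ).differentiableOn hball
  have hnconst : ∃ᶠ z in 𝓝 s₀, F z τ ≠ F s₀ τ := by
    intro hcon
    have heq := (hana τ).eqOn_of_preconnected_of_eventuallyEq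
      (g := fun _ => F s₀ τ) analyticOnNhd_const hconv hs₀' (by simpa using! hcon)
    have h4 := heq (hball (Metric.sphere_subset_closedBall hw))
    have h5 := h1 w hw
    simp only at h4
    rw [h4, sub_self, norm_zero] at h5
    linarith
  -- Quantitative open mapping: the image of the closed disc contains the ball of radius `ε / 2`
  -- about `F s₀ τ`, and that ball contains `0`.
  obtain ⟨z, hz, hz0⟩ := hdiff.ball_subset_image_closedBall hr (fun z hz => (h1 z hz).le) hnconst
    (show (0 : ℂ) ∈ Metric.ball (F s₀ τ) (ε / 2) by simpa using h2)
  exact hleast z (hball hz).le τ ⟨h3.le, hlt⟩ hz0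

/-! ### Analyticity, decay and conjugation symmetry of the loop transfer function -/

section resolvent

attribute [local instance] Matrix.linftyOpNormedRing Matrix.linftyOpNormedAlgebra

theorem loopTransfer_eq_resolvent {n : ℕ} (A₀ : Matrix (Fin n) (Fin n) ℝ) (U V : Fin n → ℝ)
    (s : ℂ) : loopTransfer A₀ U V s =
      (fun i => (V i : ℂ)) ⬝ᵥ (resolvent (A₀.map (fun x : ℝ => (x : ℂ))) s *ᵥ
        (fun i => (U i : ℂ))) := by
  rw [loopTransfer, resolvent, nonsing_inv_eq_ringInverse, Algebra.algebraMap_eq_smul_one]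

theorem differentiableAt_loopTransfer {n : ℕ} {A₀ : Matrix (Fin n) (Fin n) ℝ}
    (U V : Fin n → ℝ) {s : ℂ} (hs : s ∉ spectrum ℂ (A₀.map (fun x : ℝ => (x : ℂ)))) :
    DifferentiableAt ℂ (loopTransfer A₀ U V) s := by
  have hres : DifferentiableAt ℂ (resolvent (A₀.map (fun x : ℝ => (x : ℂ)))) s :=
    (spectrum.hasDerivAt_resolvent_const_left (spectrum.mem_resolventSet_iff.2
      (spectrum.notMem_iff.1 hs))).differentiableAt
  let ℓ : Matrix (Fin n) (Fin n) ℂ →ₗ[ℂ] ℂ :=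
    { toFun := fun M => (fun i => (V i : ℂ)) ⬝ᵥ (M *ᵥ (fun i => (U i : ℂ)))
      map_add' := fun M N => by rw [add_mulVec, dotProduct_add]
      map_smul' := fun a M => by rw [smul_mulVec, dotProduct_smul, RingHom.id_apply] }
  have h := (LinearMap.toContinuousLinearMap ℓ).differentiableAt.comp s hres
  refine h.congr_of_eventuallyEq (Eventually.of_forall fun z => ?_)
  exact loopTransfer_eq_resolvent A₀ U V z

theorem tendsto_loopTransfer_cobounded {n : ℕ} (A₀ : Matrix (Fin n) (Fin n) ℝ)
    (U V : Fin n → ℝ) :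
    Tendsto (loopTransfer A₀ U V) (Bornology.cobounded ℂ) (𝓝 0) := by
  have hres := spectrum.resolvent_tendsto_cobounded (𝕜 := ℂ) (A₀.map (fun x : ℝ => (x : ℂ)))
  have hc : Continuous fun M : Matrix (Fin n) (Fin n) ℂ =>
      (fun i => (V i : ℂ)) ⬝ᵥ (M *ᵥ (fun i => (U i : ℂ))) := by fun_prop
  have h := (hc.tendsto 0).comp hres
  simp only [zero_mulVec, dotProduct_zero] at h
  exact h.congr fun z => (loopTransfer_eq_resolvent A₀ U V z).symm

end resolvent

/-- Off the spectrum, the real and imaginary parts of the state `(sI - A₀)⁻¹ U`. -/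
theorem exists_state_of_notMem_spectrum {n : ℕ} {A₀ : Matrix (Fin n) (Fin n) ℝ}
    (U V : Fin n → ℝ) {s : ℂ} (hs : s ∉ spectrum ℂ (A₀.map (fun x : ℝ => (x : ℂ)))) :
    ∃ x y : Fin n → ℝ, A₀ *ᵥ x = s.re • x - s.im • y - U ∧ A₀ *ᵥ y = s.re • y + s.im • x ∧
      (loopTransfer A₀ U V s).re = V ⬝ᵥ x ∧ (loopTransfer A₀ U V s).im = V ⬝ᵥ y := by
  have hu : IsUnit (s • (1 : Matrix (Fin n) (Fin n) ℂ) - A₀.map (fun x : ℝ => (x : ℂ))) := by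
    have := spectrum.notMem_iff.1 hs
    rwa [Algebra.algebraMap_eq_smul_one] at this
  set M := s • (1 : Matrix (Fin n) (Fin n) ℂ) - A₀.map (fun x : ℝ => (x : ℂ)) with hM
  set z : Fin n → ℂ := M⁻¹ *ᵥ (fun i => (U i : ℂ)) with hz
  have hMz : M *ᵥ z = fun i => (U i : ℂ) := by
    rw [hz, mulVec_mulVec, mul_nonsing_inv _ ((isUnit_iff_isUnit_det _).1 hu), one_mulVec]
  rw [hM, sub_mulVec, smul_mulVec, one_mulVec] at hMz
  refine ⟨fun i => (z i).re, fun i => (z i).im, ?_, ?_, ?_, ?_⟩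
  · ext i
    have := congrArg Complex.re (congrFun hMz i)
    simp [mulVec, dotProduct] at this ⊢
    linarith
  · ext i
    have := congrArg Complex.im (congrFun hMz i)
    simp [mulVec, dotProduct] at this ⊢
    linarith
  · simp [loopTransfer, ← hM, ← hz, dotProduct]
  · simp [loopTransfer, ← hM, ← hz, dotProduct]

/-- Since `A₀`, `U` and `V` are real, conjugation commutes with every operation in `L`. This reduces
the imaginary axis to `ω ≥ 0`, the range covered by the crossover set. -/
theorem loopTransfer_conj {n : ℕ} (A₀ : Matrix (Fin n) (Fin n) ℝ) (U V : Fin n → ℝ) (s : ℂ) :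
    loopTransfer A₀ U V ((starRingEnd ℂ) s) = (starRingEnd ℂ) (loopTransfer A₀ U V s) := by
  set M := s • (1 : Matrix (Fin n) (Fin n) ℂ) - A₀.map (fun x : ℝ => (x : ℂ)) with hM
  -- `Mᴴᵀ` is the entrywise conjugate of `M`, in a form that commutes with the inverse.
  have h1 : (starRingEnd ℂ) s • (1 : Matrix (Fin n) (Fin n) ℂ) - A₀.map (fun x : ℝ => (x : ℂ)) =
      Mᴴᵀ := by
    ext i j
    by_cases h : i = j <;> simp [hM, one_apply, h, Ne.symm]
  have h2 : ∀ i j, (Mᴴᵀ)⁻¹ i j = (starRingEnd ℂ) (M⁻¹ i j) := by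
    intro i j
    rw [← transpose_nonsing_inv, ← conjTranspose_nonsing_inv]
    simp
  simp only [loopTransfer, h1, ← hM, dotProduct, mulVec, h2, map_sum, map_mul, Complex.conj_ofReal]

/-! ### From the LMI to a frequency-domain inequality -/

/-- The quadratic form of the phase LMI block matrix. -/
theorem quadForm_phaseLMIMatrix {n : ℕ} (A₀ : Matrix (Fin n) (Fin n) ℝ) (U V : Fin n → ℝ) (φ : ℝ)
    {P : Matrix (Fin n) (Fin n) ℝ} (hP : Pᵀ = P) (x : Fin n → ℝ) (w v : ℝ) :
    (Sum.elim x (Sum.elim (fun _ => w) (fun _ => v))) ⬝ᵥ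
      (phaseLMIMatrix A₀ U V φ P *ᵥ Sum.elim x (Sum.elim (fun _ => w) (fun _ => v))) =
    2 * ((P *ᵥ x) ⬝ᵥ (A₀ *ᵥ x)) - 2 * (Real.cos φ * (V ⬝ᵥ x) - w) * ((P *ᵥ x) ⬝ᵥ U)
      + 2 * v * (Real.sin φ * (V ⬝ᵥ x)) - w ^ 2 - v ^ 2 := by
  have hsymm : ∀ a b : Fin n → ℝ, a ⬝ᵥ (P *ᵥ b) = (P *ᵥ a) ⬝ᵥ b := by
    intro a b
    rw [dotProduct_mulVec, ← mulVec_transpose, hP]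
  have hφ : phaseMatrix A₀ U V φ *ᵥ x = A₀ *ᵥ x - (Real.cos φ * (V ⬝ᵥ x)) • U := by
    rw [phaseMatrix, sub_mulVec, smul_mulVec, vecMulVec_mulVec]
    ext i
    simp
    ring
  have hrow : ∀ a : Fin n → ℝ, replicateRow (Fin 1) a *ᵥ x = fun _ => a ⬝ᵥ x := fun a => rfl
  have hcol : ∀ (a : Fin n → ℝ) (t : ℝ), replicateCol (Fin 1) a *ᵥ (fun _ => t) = t • a := by
    intro a t
    ext i
    simp [mulVec, dotProduct, mul_comm]
  have hT : x ⬝ᵥ (((phaseMatrix A₀ U V φ)ᵀ * P) *ᵥ x) =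
      (P *ᵥ x) ⬝ᵥ (phaseMatrix A₀ U V φ *ᵥ x) := by
    rw [← mulVec_mulVec, dotProduct_mulVec, vecMul_transpose, dotProduct_comm]
  have hT' : x ⬝ᵥ ((P * phaseMatrix A₀ U V φ) *ᵥ x) =
      (P *ᵥ x) ⬝ᵥ (phaseMatrix A₀ U V φ *ᵥ x) := by
    rw [← mulVec_mulVec, hsymm]
  have hUP : (U ᵥ* P) = P *ᵥ U := by rw [← mulVec_transpose, hP]
  have hone : ∀ a b : ℝ, (fun _ : Fin 1 => a) ⬝ᵥ (fun _ => b) = a * b := fun a b => by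
    simp [dotProduct]
  rw [phaseLMIMatrix, fromBlocks_mulVec]
  simp only [Sum.elim_comp_inl, Sum.elim_comp_inr, fromCols_mulVec, fromRows_mulVec,
    fromBlocks_mulVec, sumElim_dotProduct_sumElim, hrow, hcol, add_mulVec, dotProduct_add, hT, hT',
    hφ, hUP, dotProduct_sub, dotProduct_smul, smul_dotProduct, smul_eq_mul, hsymm]
  simp only [neg_mulVec, one_mulVec, zero_mulVec, dotProduct_zero, dotProduct_neg, hone,
    dotProduct_comm x V, ← hsymm U x, dotProduct_comm U]
  ring

/-- The phase LMI bounds `sin φ · L` by `1 + cos φ · L` strictly on the closed right half-plane. -/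
theorem PhaseLMI.sin_sq_mul_normSq_lt {n : ℕ} {A₀ : Matrix (Fin n) (Fin n) ℝ} {U V : Fin n → ℝ}
    {φ : ℝ} (h : PhaseLMI A₀ U V φ) {s : ℂ} (hs : 0 ≤ s.re)
    (hspec : s ∉ spectrum ℂ (A₀.map (fun x : ℝ => (x : ℂ)))) :
    Real.sin φ ^ 2 * ((loopTransfer A₀ U V s).re ^ 2 + (loopTransfer A₀ U V s).im ^ 2) <
      (1 + Real.cos φ * (loopTransfer A₀ U V s).re) ^ 2 +
        (Real.cos φ * (loopTransfer A₀ U V s).im) ^ 2 := by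
  obtain ⟨P, hP, hM⟩ := h
  obtain ⟨x, y, hx, hy, hre, him⟩ := exists_state_of_notMem_spectrum U V hspec
  rw [hre, him]
  have hPT : Pᵀ = P := by simpa using hP.isHermitian.eq
  have hsymm : (P *ᵥ y) ⬝ᵥ x = (P *ᵥ x) ⬝ᵥ y := by
    rw [dotProduct_comm, dotProduct_mulVec, ← mulVec_transpose, hPT]
  have hPnonneg : ∀ z : Fin n → ℝ, 0 ≤ (P *ᵥ z) ⬝ᵥ z := by
    intro z
    have := hP.posSemidef.dotProduct_mulVec_nonneg z
    rwa [star_trivial, dotProduct_comm] at this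
  -- The entry `1 + cos φ · (V ⬝ᵥ x)` makes the coefficient of `(P *ᵥ x) ⬝ᵥ U` cancel the `-U` in
  -- `A₀ *ᵥ x`. The vector is nonzero because this entry is `1` when `x = 0`; this is what makes the
  -- final inequality strict.
  have hne : Sum.elim x (Sum.elim (fun _ : Fin 1 => 1 + Real.cos φ * (V ⬝ᵥ x))
      (fun _ : Fin 1 => Real.sin φ * (V ⬝ᵥ x))) ≠ 0 := by
    intro h0
    have hx0 : x = 0 := funext fun i => congrFun h0 (Sum.inl i)
    have := congrFun h0 (Sum.inr (Sum.inl 0))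
    simp [hx0] at this
  have h1 := hM.dotProduct_mulVec_pos hne
  have h2 := hM.posSemidef.dotProduct_mulVec_nonneg
    (Sum.elim y (Sum.elim (fun _ => Real.cos φ * (V ⬝ᵥ y)) (fun _ => Real.sin φ * (V ⬝ᵥ y))))
  rw [star_trivial, neg_mulVec, dotProduct_neg, quadForm_phaseLMIMatrix A₀ U V φ hPT] at h1 h2
  simp only [hx, hy, dotProduct_sub, dotProduct_add, dotProduct_smul, smul_eq_mul] at h1 h2
  -- When the two forms are added, the cross terms in `s.im` cancel by symmetry of `P`; the terms in
  -- `s.re` have a favourable sign.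
  rw [hsymm] at h2
  linarith [mul_nonneg hs (hPnonneg x), mul_nonneg hs (hPnonneg y)]

end SafetyFilter

/-! ### The delay margin -/

theorem mainTheorem8 {n m : ℕ}
    (A : Matrix (Fin n) (Fin n) ℝ) (B : Matrix (Fin n) (Fin m) ℝ)
    (K : Matrix (Fin m) (Fin n) ℝ) (G : Matrix (Fin m) (Fin m) ℝ)
    (c : Fin n → ℝ) (α : ℝ)
    (hα : 0 < α) (hG : G.PosDef) (hcB : Matrix.vecMul c B ≠ 0)
    (A₀ : Matrix (Fin n) (Fin n) ℝ) (hA₀ : A₀ = A - B * K)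
    (hHurwitz : SafetyFilter.IsHurwitz A₀)
    (U V : Fin n → ℝ)
    (hU : U = SafetyFilter.inputDirection B c G)
    (hV : V = SafetyFilter.outputVector A₀ c α)
    (hne : (SafetyFilter.gainCrossoverSet A₀ U V).Nonempty)
    (hbdd : BddAbove (SafetyFilter.gainCrossoverSet A₀ U V))
    (ωmax : ℝ) (hωmax : ωmax = sSup (SafetyFilter.gainCrossoverSet A₀ U V))
    (φbar : ℝ) (hφ : φbar ∈ Set.Icc 0 (Real.pi / 2))
    (hLMI : SafetyFilter.PhaseLMI A₀ U V φbar) :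
    ∀ τ : ℝ, 0 ≤ τ → (ωmax ≠ 0 → τ ≤ φbar / ωmax) →
      ∀ s : ℂ, 0 ≤ s.re →
        1 + Complex.exp (-(s * (τ : ℂ))) * SafetyFilter.loopTransfer A₀ U V s ≠ 0 := by
  intro T hT hTφ
  have hspec : ∀ s : ℂ, 0 ≤ s.re → s ∉ spectrum ℂ (A₀.map (fun x : ℝ => (x : ℂ))) :=
    fun s hs hmem => (hHurwitz s hmem).not_ge hs
  have hsc := Real.sin_sq_add_cos_sq φbar
  have hcos : 0 ≤ Real.cos φbar :=
    Real.cos_nonneg_of_mem_Icc ⟨by linarith [hφ.1, Real.pi_pos], hφ.2⟩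
  have hωnonneg : 0 ≤ ωmax := by
    obtain ⟨ω, hω⟩ := hne
    exact hω.1.trans (hωmax ▸ le_csSup hbdd hω)
  -- on the unit circle, the phase of the loop stays strictly away from `π - φbar`
  have hphase : ∀ s : ℂ, 0 ≤ s.re → ‖SafetyFilter.loopTransfer A₀ U V s‖ = 1 →
      -Real.cos φbar < (SafetyFilter.loopTransfer A₀ U V s).re := by
    intro s hs hnorm
    have h := hLMI.sin_sq_mul_normSq_lt hs (hspec s hs)
    have hn : (SafetyFilter.loopTransfer A₀ U V s).re ^ 2 +
        (SafetyFilter.loopTransfer A₀ U V s).im ^ 2 = 1 := by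
      have := Complex.sq_norm_sub_sq_re (SafetyFilter.loopTransfer A₀ U V s)
      rw [hnorm] at this
      linarith
    rw [hn] at h
    -- With `|L| = 1` and `sin² + cos² = 1` the inequality becomes `0 < 2 cos φ (cos φ + Re L)`, and
    -- `cos φ ≥ 0`.
    nlinarith
  -- the imaginary axis, upper half
  have hupper : ∀ τ ∈ Set.Icc 0 T, ∀ ω : ℝ, 0 ≤ ω →
      1 + Complex.exp (-((ω * Complex.I : ℂ) * (τ : ℂ))) *
        SafetyFilter.loopTransfer A₀ U V (ω * Complex.I) ≠ 0 := by
    intro τ hτ ω hω h0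
    have hL : SafetyFilter.loopTransfer A₀ U V (ω * Complex.I) =
        -Complex.exp (((ω * τ : ℝ) : ℂ) * Complex.I) := by
      have he : Complex.exp (((ω * τ : ℝ) : ℂ) * Complex.I) *
          Complex.exp (-((ω * Complex.I : ℂ) * (τ : ℂ))) = 1 := by
        rw [← Complex.exp_add, ← Complex.exp_zero]
        congr 1
        push_cast
        ring
      linear_combination Complex.exp (((ω * τ : ℝ) : ℂ) * Complex.I) * h0 -
        SafetyFilter.loopTransfer A₀ U V (ω * Complex.I) * he
    have hnorm : ‖SafetyFilter.loopTransfer A₀ U V (ω * Complex.I)‖ = 1 := by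
      rw [hL, norm_neg, Complex.norm_exp_ofReal_mul_I]
    have hωle : ω ≤ ωmax := hωmax ▸ le_csSup hbdd ⟨hω, hnorm⟩
    have hangle : ω * τ ≤ φbar := by
      -- If `ωmax = 0` the only possible crossover is `ω = 0`, so the angle is zero whatever the
      -- delay.
      rcases hωnonneg.eq_or_lt with h | h
      · rw [le_antisymm (h ▸ hωle) hω, zero_mul]
        exact hφ.1
      · have h1 := (le_div_iff₀ h).1 (hTφ h.ne')
        nlinarith [mul_le_mul hωle hτ.2 hτ.1 hωnonneg]
    have hlt := hphase _ (by simp) hnorm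
    rw [hL, Complex.neg_re, Complex.exp_ofReal_mul_I_re] at hlt
    have := Real.cos_le_cos_of_nonneg_of_le_pi (mul_nonneg hω hτ.1)
      (by linarith [hφ.2, Real.pi_pos]) hangle
    linarith
  refine SafetyFilter.one_add_exp_mul_ne_zero_of_axis
    (fun s hs => SafetyFilter.differentiableAt_loopTransfer U V (hspec s hs))
    (SafetyFilter.tendsto_loopTransfer_cobounded A₀ U V) hT ?_ ?_
  · intro s hs h0
    have hL : SafetyFilter.loopTransfer A₀ U V s = -1 := by linear_combination h0
    have := hphase s hs (by rw [hL, norm_neg, norm_one])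
    rw [hL, Complex.neg_re, Complex.one_re] at this
    linarith [Real.cos_le_one φbar]
  · intro τ hτ s hs h0
    rcases le_total 0 s.im with him | him
    · have hs' : s = (s.im : ℂ) * Complex.I := by
        apply Complex.ext <;> simp [hs]
      rw [hs'] at h0
      exact hupper τ hτ s.im him h0
    · have hs' : (starRingEnd ℂ) s = ((-s.im : ℝ) : ℂ) * Complex.I := by
        apply Complex.ext <;> simp [hs]
      have h1 := congrArg (starRingEnd ℂ) h0
      rw [map_add, map_mul, map_one, map_zero, ← SafetyFilter.loopTransfer_conj,
        ← Complex.exp_conj, map_neg, map_mul, Complex.conj_ofReal, hs'] at h1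
      exact hupper τ hτ (-s.im) (by linarith) h1
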